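/- Let $a,b,\delta>0$, and let $\mathcal G$ be the "signpost" metric graph with these lengths: take the real line with vertices at the points $i\delta$, $i\in\mathbb Z$; to each of these vertices attach one end of an edge ("vertical edge") of length $b$, and to the other end of each vertical edge attach a circle (self-loop) of length $a$. For $p\ge 1$ let $\|u\|_{L^p(\mathcal G)}^p=\sum_e\int_e|u|^p\,dx$, the sum being over all edges $e$ of $\mathcal G$, and let $H^1(\mathcal G)$ be the space of continuous functions $u:\mathcal G\to\mathbb R$ whose restriction to each edge is in $H^1$ and for which $\|u\|_{L^2(\mathcal G)}$ and $\|u'\|_{L^2(\mathcal G)}$ are finite. For $X=\mathcal G$ and for $X=\mathbb R$ let $C_X$ be the optimal (smallest) constant in the Gagliardo–Nirenberg inequality $$\|u\|_{L^6(X)}^6\le C_X\,\|u\|_{L^2(X)}^4\,\|u'\|_{L^2(X)}^2\qquad\text{for all }u\in H^1(X),$$ and let $\mu_X:=\sqrt{3/C_X}$ be the critical mass. Then both critical masses are positive and finite, and $$\mu_{\mathcal G}<\mu_{\mathbb R}.$$ -/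

import Mathlib

open MeasureTheory Set
open scoped ENNReal ContDiff

/-- `g` is the weak derivative of `u` on the open set `I ⊆ ℝ`: one has `∫ u η' = - ∫ g η` for every
smooth function `η` whose support is compact and contained in `I`. -/
def HasWeakDerivOn (I : Set ℝ) (u g : ℝ → ℝ) : Prop :=
  ∀ η : ℝ → ℝ, ContDiff ℝ ∞ η → HasCompactSupport η → tsupport η ⊆ I →
    ∫ x in I, u x * deriv η x = - ∫ x in I, g x * η x

/-- The function `u` is in `H¹(I)`, with weak derivative `g`. -/
structure IsH1On (I : Set ℝ) (u g : ℝ → ℝ) : Prop where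
  memLp : MemLp u 2 (volume.restrict I)
  memLp_deriv : MemLp g 2 (volume.restrict I)
  weakDeriv : HasWeakDerivOn I u g

/-- `∫_I |f| ^ p`, with values in `[0, ∞]`. -/
noncomputable def powNormOn (I : Set ℝ) (p : ℕ) (f : ℝ → ℝ) : ℝ≥0∞ :=
  ∫⁻ x in I, ‖f x‖ₑ ^ p

/-- A metric graph with edges of finite length. The edge `e` is identified with the interval
`[0, len e]`, the point `0` being the vertex `src e` and the point `len e` being `tgt e`.
Multiple edges and self-loops are allowed. -/
structure MetricGraph where
  /-- vertices -/
  V : Type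
  /-- edges -/
  E : Type
  /-- the vertex at the coordinate `0` of an edge -/
  src : E → V
  /-- the vertex at the coordinate `len e` of an edge -/
  tgt : E → V
  /-- the length of an edge -/
  len : E → ℝ
  len_pos : ∀ e, 0 < len e

namespace MetricGraph

/-- `∫_G |u| ^ p`, the `p`-th power of the `L^p(G)` norm of a function `u = (u_e)_e` on `G`. -/
noncomputable def powNorm (G : MetricGraph) (p : ℕ) (u : G.E → ℝ → ℝ) : ℝ≥0∞ :=
  ∑' e, powNormOn (Ioo 0 (G.len e)) p (u e)

/-- A function on `G`, given by its restrictions `u e : [0, len e] → ℝ` to the edges (only the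
values on these intervals matter), is continuous if it is continuous on each edge and the values
at the ends of the edges match at each vertex. -/
def IsContinuous (G : MetricGraph) (u : G.E → ℝ → ℝ) : Prop :=
  (∀ e, ContinuousOn (u e) (Icc 0 (G.len e))) ∧
    ∃ val : G.V → ℝ, ∀ e, u e 0 = val (G.src e) ∧ u e (G.len e) = val (G.tgt e)

/-- The function `u` is in `H¹(G)`, with (edgewise weak) derivative `g`. -/
structure IsH1 (G : MetricGraph) (u g : G.E → ℝ → ℝ) : Prop where
  cont : G.IsContinuous u
  edge : ∀ e, IsH1On (Ioo 0 (G.len e)) (u e) (g e)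
  sq_lt_top : G.powNorm 2 u < ⊤
  sq_deriv_lt_top : G.powNorm 2 g < ⊤

/-- The optimal constant `C_G` of the critical Gagliardo-Nirenberg inequality
`‖u‖_6^6 ≤ C ‖u‖_2^4 ‖u'‖_2^2` on `H¹(G)`; it is `∞` if there is no finite constant. -/
noncomputable def gnConst (G : MetricGraph) : ℝ≥0∞ :=
  sInf {C | ∀ u g, G.IsH1 u g → G.powNorm 6 u ≤ C * G.powNorm 2 u ^ 2 * G.powNorm 2 g}

/-- The critical mass `μ_G = √(3 / C_G)`, with values in `[0, ∞]`. -/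
noncomputable def criticalMass (G : MetricGraph) : ℝ≥0∞ :=
  (3 / G.gnConst) ^ (1 / 2 : ℝ)

end MetricGraph

/-- The optimal constant of the critical Gagliardo-Nirenberg inequality on the real line. -/
noncomputable def lineGNConst : ℝ≥0∞ :=
  sInf {C | ∀ u g : ℝ → ℝ, Continuous u → IsH1On univ u g →
    powNormOn univ 6 u ≤ C * powNormOn univ 2 u ^ 2 * powNormOn univ 2 g}

/-- The critical mass `μ_ℝ` of the real line. -/
noncomputable def lineCriticalMass : ℝ≥0∞ :=
  (3 / lineGNConst) ^ (1 / 2 : ℝ)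

/-- A compact graph with two disjoint nonempty sets of vertices (donors and receivers) and a
bijection between them: the data from which a periodic graph is built. -/
structure PeriodicityCell extends MetricGraph where
  finite_V : Finite V
  finite_E : Finite E
  /-- donors -/
  D : Set V
  /-- receivers -/
  R : Set V
  D_nonempty : D.Nonempty
  R_nonempty : R.Nonempty
  disjoint : Disjoint D R
  /-- the pasting rule -/
  σ : D ≃ R

namespace PeriodicityCell

/-- Each donor of the `i`-th copy of the cell is glued to its image in the `(i+1)`-th copy. -/
inductive Glue (K : PeriodicityCell) : ℤ × K.V → ℤ × K.V → Prop
  | paste (i : ℤ) (v : K.D) : Glue K (i, (v : K.V)) (i + 1, (K.σ v : K.V))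

/-- The periodic graph made of the copies, indexed by `ℤ`, of the cell `K`, whose vertices are
identified by the equivalence relation generated by `Glue`. -/
def periodicGraph (K : PeriodicityCell) : MetricGraph where
  V := Quot K.Glue
  E := ℤ × K.E
  src e := Quot.mk _ (e.1, K.src e.2)
  tgt e := Quot.mk _ (e.1, K.tgt e.2)
  len e := K.len e.2
  len_pos e := K.len_pos e.2

end PeriodicityCell

/-- The vertices of the signpost cell: the two ends `base` and `next` of the horizontal edge, and
the point `top` where the circle is attached to the vertical edge. -/
inductive SignpostVertex
  | base
  | next
  | top

/-- The edges of the signpost cell: a circle, a vertical edge, and a horizontal edge. -/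
inductive SignpostEdge
  | circle
  | vertical
  | horizontal

/-- The cell of the signpost graph: the horizontal edge goes from `base` to `next`, the vertical
edge from `base` to `top`, and the circle is a loop at `top`. The vertex `next` of each copy is
glued to the vertex `base` of the following one. -/
noncomputable def signpostCell (circ vert horiz : ℝ) (hc : 0 < circ) (hv : 0 < vert)
    (hh : 0 < horiz) : PeriodicityCell where
  V := SignpostVertex
  E := SignpostEdge
  src
    | .circle => .top
    | .vertical => .base
    | .horizontal => .base
  tgt
    | .circle => .top
    | .vertical => .top
    | .horizontal => .next
  len
    | .circle => circ
    | .vertical => vert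
    | .horizontal => horiz
  len_pos
    | .circle => hc
    | .vertical => hv
    | .horizontal => hh
  finite_V := Finite.of_surjective
    (fun i : Fin 3 => ![SignpostVertex.base, SignpostVertex.next, SignpostVertex.top] i)
    (by rintro (_ | _ | _); exacts [⟨0, rfl⟩, ⟨1, rfl⟩, ⟨2, rfl⟩])
  finite_E := Finite.of_surjective
    (fun i : Fin 3 =>
      ![SignpostEdge.circle, SignpostEdge.vertical, SignpostEdge.horizontal] i)
    (by rintro (_ | _ | _); exacts [⟨0, rfl⟩, ⟨1, rfl⟩, ⟨2, rfl⟩])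
  D := {SignpostVertex.next}
  R := {SignpostVertex.base}
  D_nonempty := ⟨_, rfl⟩
  R_nonempty := ⟨_, rfl⟩
  disjoint := by simp
  σ := Equiv.ofUnique _ _

/-- The signpost graph: at equally spaced points of a horizontal line, a vertical edge is attached,
with a circle attached to its other end. The parameters are the length of each circle, the length
of each vertical edge and the spacing. -/
noncomputable def signpostGraph (circ vert horiz : ℝ) (hc : 0 < circ) (hv : 0 < vert)
    (hh : 0 < horiz) : MetricGraph :=
  (signpostCell circ vert horiz hc hv hh).periodicGraph

/-!
The critical mass is a decreasing function of the optimal constant, so the claim is that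
`0 < C_ℝ < C_G < ∞`. The number `4 / π²` separates the two constants.

*The line.* `C_ℝ ≤ 4 / π²` (`IsH1On.integral_pow_six_le`) follows by completing a square: with
`M = sup |u|` and `F(t) = t √(M⁴ - t⁴)`, the inequality `2 k |F(u) u'| ≤ u'² + k² F(u)²` is
integrated over the line. The left side is at least `4 k ∫₀^M F = k π M⁴ / 2`, since `u` climbs
from `0` to its maximum and descends to `0`. The choice `k = π / (2 ∫ u²)` makes the terms with `M`
cancel and leaves the sharp inequality. It needs the chain rule for weak derivatives
(`HasWeakDerivOn.integral_comp_mul`), which follows from the du Bois-Reymond lemma and the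
fundamental theorem of calculus for absolutely continuous functions.

*The graph, from above.* `C_G < ∞` because `sup u² ≤ 6 ∫ |u u'|`: every point is joined to infinity
by a path along which `u` tends to `0` (`MetricGraph.IsH1.sq_le_of_ray`).

*The graph, from below.* `C_G > 4 / π²` (`ofReal_lt_signpostGraph_gnConst`) by a competitor supported
on one circle and its vertical edge. A soliton of the line attains `4 / π²`. It is concentrated on
the circle, its two tails are cut off at the point where the circle is attached, and they are
replaced by a single tail, vanishing at the foot of the vertical edge. One tail instead of two
lowers the mass and the kinetic energy to first order in the squared value at the cut, whereas
the integral of the sixth power is lowered only to third order (`four_mul_sq_mul_lt`).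
-/

/-! ### Weak derivatives on an interval -/

/-- A test function on `(a, b)` with vanishing integral is the derivative of a test function. -/
lemma exists_testFunction_primitive {a b : ℝ} {θ : ℝ → ℝ} (hθ : ContDiff ℝ ∞ θ)
    (hsupp : tsupport θ ⊆ Ioo a b) (hcomp : HasCompactSupport θ) (hint : ∫ t, θ t = 0) :
    ∃ Θ : ℝ → ℝ, ContDiff ℝ ∞ Θ ∧ HasCompactSupport Θ ∧ tsupport Θ ⊆ Ioo a b ∧ deriv Θ = θ := by
  rcases (tsupport θ).eq_empty_or_nonempty with h0 | hne
  · have : θ = 0 := by rwa [tsupport_eq_empty_iff] at h0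
    subst this
    exact ⟨0, contDiff_const, HasCompactSupport.zero, by simp, by ext x; simp⟩
  have hm := hsupp (hcomp.isCompact.sInf_mem hne)
  have hM := hsupp (hcomp.isCompact.sSup_mem hne)
  set p := sInf (tsupport θ)
  set q := sSup (tsupport θ)
  have hmem : ∀ t, θ t ≠ 0 → t ∈ Icc p q := fun t ht ↦
    ⟨csInf_le hcomp.isCompact.bddBelow (subset_tsupport θ ht),
      le_csSup hcomp.isCompact.bddAbove (subset_tsupport θ ht)⟩
  have hder : ∀ x, HasDerivAt (fun x ↦ ∫ t in a..x, θ t) (θ x) x := fun x ↦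
    intervalIntegral.integral_hasDerivAt_right (hθ.continuous.intervalIntegrable _ _)
      (hθ.continuous.stronglyMeasurableAtFilter _ _) hθ.continuous.continuousAt
  have hd : deriv (fun x ↦ ∫ t in a..x, θ t) = θ := funext fun x ↦ (hder x).deriv
  -- to the right of `q` the primitive is the total integral of `θ`
  have hzero : ∀ x, x ∉ Icc p q → ∫ t in a..x, θ t = 0 := by
    intro x hx
    by_cases hxp : x < p
    · refine intervalIntegral.integral_zero_ae (Filter.Eventually.of_forall fun t ht ↦ ?_)
      by_contra h
      have h1 := (hmem t h).1
      have h2 : t ≤ max a x := ht.2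
      exact absurd (h1.trans h2) (not_le.2 (max_lt hm.1 hxp))
    · have hqx : q < x := by
        by_contra h
        exact hx ⟨not_lt.1 hxp, not_lt.1 h⟩
      rw [intervalIntegral.integral_eq_integral_of_support_subset, hint]
      intro t ht
      exact ⟨hm.1.trans_le (hmem t ht).1, (hmem t ht).2.trans hqx.le⟩
  have hts : tsupport (fun x ↦ ∫ t in a..x, θ t) ⊆ Icc p q :=
    closure_minimal (fun x hx ↦ by
      by_contra h
      exact hx (hzero x h)) isClosed_Icc
  refine ⟨fun x ↦ ∫ t in a..x, θ t, ?_, ?_, ?_, hd⟩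
  · rw [contDiff_infty_iff_deriv, hd]
    exact ⟨fun x ↦ (hder x).differentiableAt, hθ⟩
  · exact HasCompactSupport.of_support_subset_isCompact isCompact_Icc
      ((subset_tsupport _).trans hts)
  · exact hts.trans (fun x hx ↦ ⟨hm.1.trans_le hx.1, hx.2.trans_lt hM.2⟩)

/-- The du Bois-Reymond lemma: a continuous function with vanishing weak derivative is constant. -/
lemma exists_eqOn_const_of_integral_mul_deriv_eq_zero {a b : ℝ} (hab : a < b) {v : ℝ → ℝ}
    (hv : ContinuousOn v (Icc a b))
    (h : ∀ η : ℝ → ℝ, ContDiff ℝ ∞ η → HasCompactSupport η → tsupport η ⊆ Ioo a b →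
      ∫ x in Ioo a b, v x * deriv η x = 0) :
    ∃ c, EqOn v (fun _ ↦ c) (Icc a b) := by
  let φ : ContDiffBump ((a + b) / 2) :=
    ⟨(b - a) / 8, (b - a) / 4, by linarith, by linarith⟩
  set ρ : ℝ → ℝ := φ.normed volume
  have hρ : ContDiff ℝ ∞ ρ := φ.contDiff_normed
  have hρc : HasCompactSupport ρ := φ.hasCompactSupport_normed
  have hρs : tsupport ρ ⊆ Ioo a b := by
    rw [φ.tsupport_normed_eq]
    intro x hx
    rw [Metric.mem_closedBall, Real.dist_eq, abs_le] at hx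
    change -((b - a) / 4) ≤ _ ∧ _ ≤ (b - a) / 4 at hx
    exact ⟨by linarith [hx.1], by linarith [hx.2]⟩
  have hρi : ∫ x, ρ x = 1 := φ.integral_normed
  have hvi : IntegrableOn v (Ioo a b) :=
    (hv.integrableOn_Icc).mono_set Ioo_subset_Icc_self
  have hmul : ∀ f : ℝ → ℝ, Continuous f → IntegrableOn (fun x ↦ v x * f x) (Ioo a b) := by
    intro f hf
    exact ((hv.mul hf.continuousOn).integrableOn_Icc).mono_set Ioo_subset_Icc_self
  set c := ∫ x in Ioo a b, v x * ρ x
  have key : ∀ᵐ x ∂volume, x ∈ Ioo a b → v x - c = 0 := by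
    refine isOpen_Ioo.ae_eq_zero_of_integral_contDiff_smul_eq_zero
      ((hvi.sub (integrableOn_const (by simp))).locallyIntegrableOn) ?_
    intro η hη hηc hηs
    set s := ∫ x, η x
    -- `η - s ρ` has vanishing integral, so it is an admissible derivative in `h`
    have hηi : Integrable η := hη.continuous.integrable_of_hasCompactSupport hηc
    have hρint : Integrable ρ := hρ.continuous.integrable_of_hasCompactSupport hρc
    obtain ⟨Θ, h1, h2, h3, h4⟩ := exists_testFunction_primitive (a := a) (b := b)
      (θ := fun x ↦ η x - s * ρ x) (hη.sub (contDiff_const.mul hρ))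
      ((tsupport_sub η (fun x ↦ s * ρ x)).trans (union_subset hηs
        ((tsupport_mul_subset_right (f := fun _ ↦ s) (g := ρ)).trans hρs)))
      (hηc.sub (hρc.mul_left (f := fun _ ↦ s)))
      (by rw [integral_sub hηi (hρint.const_mul s), integral_const_mul, hρi]; simp [s])
    have h5 := h Θ h1 h2 h3
    rw [h4] at h5
    have e1 : ∫ x in Ioo a b, v x * (η x - s * ρ x)
        = (∫ x in Ioo a b, v x * η x) - s * c := by
      rw [← integral_const_mul, ← integral_sub (hmul _ hη.continuous)
        ((hmul _ hρ.continuous).const_mul s)]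
      congr 1; ext x; ring
    have hηset : ∫ x in Ioo a b, η x = s :=
      setIntegral_eq_integral_of_forall_compl_eq_zero fun x hx ↦ by
        by_contra hne
        exact hx (hηs (subset_tsupport η hne))
    have e2 : ∫ x, η x • (v x - c) = ∫ x in Ioo a b, (v x * η x - c * η x) := by
      rw [← setIntegral_eq_integral_of_forall_compl_eq_zero (s := Ioo a b)]
      · congr 1; ext x; simp; ring
      · intro x hx
        have : η x = 0 := by
          by_contra hne
          exact hx (hηs (subset_tsupport η hne))
        simp [this]
    rw [e2, integral_sub (hmul _ hη.continuous) (hηi.integrableOn.const_mul c),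
      integral_const_mul, hηset]
    linarith
  have hIoo : EqOn v (fun _ ↦ c) (Ioo a b) := by
    refine Measure.eqOn_open_of_ae_eq (μ := volume) ?_ isOpen_Ioo
      (hv.mono Ioo_subset_Icc_self) continuousOn_const
    rw [Filter.EventuallyEq, ae_restrict_iff' measurableSet_Ioo]
    filter_upwards [key] with x hx hxm
    linarith [hx hxm]
  refine ⟨c, hIoo.of_subset_closure hv continuousOn_const Ioo_subset_Icc_self ?_⟩
  rw [closure_Ioo hab.ne]

/-- The fundamental theorem of calculus for weak derivatives. -/
lemma HasWeakDerivOn.eq_add_integral {a b : ℝ} (hab : a < b) {u g : ℝ → ℝ}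
    (h : HasWeakDerivOn (Ioo a b) u g) (hu : ContinuousOn u (Icc a b))
    (hg : IntegrableOn g (Ioo a b)) {x : ℝ} (hx : x ∈ Icc a b) :
    u x = u a + ∫ t in a..x, g t := by
  have hgi : IntervalIntegrable g volume a b := by
    rwa [intervalIntegrable_iff_integrableOn_Ioo_of_le hab.le]
  set G : ℝ → ℝ := fun x ↦ ∫ t in a..x, g t
  have hG : AbsolutelyContinuousOnInterval G a b :=
    hgi.absolutelyContinuousOnInterval_intervalIntegral (by simp)
  have hGc : ContinuousOn G (Icc a b) := by
    have := hG.continuousOn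
    rwa [uIcc_of_le hab.le] at this
  obtain ⟨c, hc⟩ := exists_eqOn_const_of_integral_mul_deriv_eq_zero hab (hu.sub hGc) (by
    intro η hη hηc hηs
    have hη' : Continuous (deriv η) := hη.continuous_deriv (by simp)
    have hηac : AbsolutelyContinuousOnInterval η a b :=
      ContDiffOn.absolutelyContinuousOnInterval ((hη.of_le (by simp)).contDiffOn)
    have hηa : η a = 0 := by
      by_contra hne
      exact lt_irrefl a (hηs (subset_tsupport η hne)).1
    have hηb : η b = 0 := by
      by_contra hne
      exact lt_irrefl b (hηs (subset_tsupport η hne)).2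
    have parts := hG.integral_mul_deriv_eq_deriv_mul hηac
    rw [hηa, hηb, mul_zero, mul_zero, sub_zero, zero_sub] at parts
    have e : ∫ x in a..b, deriv G x * η x = ∫ x in a..b, g x * η x := by
      refine intervalIntegral.integral_congr_ae ?_
      filter_upwards [hgi.ae_hasDerivAt_integral] with x hx hxm
      rw [(hx (uIoc_subset_uIcc hxm) a (by simp)).deriv]
    rw [e] at parts
    simp only [intervalIntegral.integral_of_le hab.le, integral_Ioc_eq_integral_Ioo] at parts
    have i1 : IntegrableOn (fun x ↦ u x * deriv η x) (Ioo a b) :=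
      (hu.mul hη'.continuousOn).integrableOn_Icc.mono_set Ioo_subset_Icc_self
    have i2 : IntegrableOn (fun x ↦ G x * deriv η x) (Ioo a b) :=
      (hGc.mul hη'.continuousOn).integrableOn_Icc.mono_set Ioo_subset_Icc_self
    simp only [Pi.sub_apply, sub_mul]
    rw [integral_sub i1 i2, parts, h η hη hηc hηs, sub_self])
  have h1 := hc hx
  have h2 := hc (left_mem_Icc.2 hab.le)
  simp only [Pi.sub_apply, G, intervalIntegral.integral_same] at h1 h2
  linarith

lemma LipschitzOnWith.comp_absolutelyContinuousOnInterval {K : NNReal} {Φ u : ℝ → ℝ} {s : Set ℝ}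
    {a b : ℝ} (hΦ : LipschitzOnWith K Φ s) (hu : AbsolutelyContinuousOnInterval u a b)
    (hs : MapsTo u (uIcc a b) s) : AbsolutelyContinuousOnInterval (fun x ↦ Φ (u x)) a b := by
  rw [absolutelyContinuousOnInterval_iff] at hu ⊢
  intro ε hε
  obtain ⟨δ, hδ, h⟩ := hu (ε / (K + 1)) (by positivity)
  refine ⟨δ, hδ, fun E hE hlt ↦ ?_⟩
  have h1 := h E hE hlt
  rw [lt_div_iff₀ (by positivity), mul_comm] at h1
  refine lt_of_le_of_lt ?_ h1
  rw [Finset.mul_sum]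
  refine Finset.sum_le_sum fun i hi ↦ ?_
  refine (hΦ.dist_le_mul _ (hs (hE.1 i hi).1) _ (hs (hE.1 i hi).2)).trans ?_
  gcongr
  linarith

/-- The chain rule, in integrated form, for weak derivatives. -/
lemma HasWeakDerivOn.integral_comp_mul {a b : ℝ} (hab : a < b) {u g Φ F : ℝ → ℝ}
    (h : HasWeakDerivOn (Ioo a b) u g) (hu : ContinuousOn u (Icc a b))
    (hg : IntegrableOn g (Ioo a b)) (hΦ : ∀ t, HasDerivAt Φ (F t) t) (hF : Continuous F)
    {x y : ℝ} (hx : x ∈ Icc a b) (hy : y ∈ Icc a b) :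
    ∫ t in x..y, F (u t) * g t = Φ (u y) - Φ (u x) := by
  have hgi : IntervalIntegrable g volume a b := by
    rwa [intervalIntegrable_iff_integrableOn_Ioo_of_le hab.le]
  have hsub : uIcc x y ⊆ uIcc a b := by
    rw [uIcc_of_le hab.le]; exact uIcc_subset_Icc hx hy
  set G : ℝ → ℝ := fun x ↦ u a + ∫ t in a..x, g t
  have huG : ∀ x ∈ Icc a b, u x = G x := fun x hx ↦ h.eq_add_integral hab hu hg hx
  have hGac : AbsolutelyContinuousOnInterval G a b := by
    refine AbsolutelyContinuousOnInterval.fun_add ?_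
      (hgi.absolutelyContinuousOnInterval_intervalIntegral (by simp))
    exact ContDiffOn.absolutelyContinuousOnInterval contDiffOn_const
  have hG : AbsolutelyContinuousOnInterval G x y := hGac.mono hsub
  obtain ⟨R, hR⟩ := hG.exists_bound
  have hmaps : MapsTo G (uIcc x y) (Icc (-R) R) := fun z hz ↦ abs_le.1 (hR z hz)
  obtain ⟨C, hC⟩ := (isCompact_Icc (a := -R) (b := R)).exists_bound_of_continuousOn
    hF.continuousOn
  have hlip : LipschitzOnWith C.toNNReal Φ (Icc (-R) R) :=
    (convex_Icc _ _).lipschitzOnWith_of_nnnorm_hasDerivWithin_le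
      (fun t _ ↦ (hΦ t).hasDerivWithinAt) fun t ht ↦ by
        rw [← NNReal.coe_le_coe, coe_nnnorm]
        exact (hC t ht).trans (Real.le_coe_toNNReal C)
  have hac := hlip.comp_absolutelyContinuousOnInterval hG hmaps
  have := hac.integral_deriv_eq_sub
  rw [huG x hx, huG y hy, ← this]
  refine intervalIntegral.integral_congr_ae ?_
  filter_upwards [hgi.ae_hasDerivAt_integral] with t ht htm
  have htm' : t ∈ uIcc a b := hsub (uIoc_subset_uIcc htm)
  have hd : HasDerivAt G (g t) t := (ht htm' a (by simp)).const_add _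
  rw [uIcc_of_le hab.le] at htm'
  rw [huG t htm']
  exact ((hΦ (G t)).comp t hd).deriv.symm

lemma HasWeakDerivOn.mono {I J : Set ℝ} {u g : ℝ → ℝ} (h : HasWeakDerivOn I u g) (hJI : J ⊆ I)
    (hI : MeasurableSet I) : HasWeakDerivOn J u g := by
  intro η hη hηc hηs
  have h1 := h η hη hηc (hηs.trans hJI)
  rw [setIntegral_eq_of_subset_of_forall_sdiff_eq_zero hI hJI,
    setIntegral_eq_of_subset_of_forall_sdiff_eq_zero (f := fun x ↦ g x * η x) hI hJI] at h1
  · exact h1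
  · intro x hx
    have : η x = 0 := by
      by_contra hne
      exact hx.2 (hηs (subset_tsupport η hne))
    simp [this]
  · intro x hx
    have : deriv η x = 0 := by
      by_contra hne
      exact hx.2 (hηs (support_deriv_subset hne))
    simp [this]

/-- A continuously differentiable function is weakly differentiable on a bounded interval. -/
lemma hasWeakDerivOn_Ioo_of_hasDerivAt {a b : ℝ} (hab : a ≤ b) {u g : ℝ → ℝ}
    (hu : ∀ x, HasDerivAt u (g x) x) (hg : Continuous g) : HasWeakDerivOn (Ioo a b) u g := by
  intro η hη hηc hηs
  have hηa : η a = 0 := by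
    by_contra hne
    exact lt_irrefl a (hηs (subset_tsupport η hne)).1
  have hηb : η b = 0 := by
    by_contra hne
    exact lt_irrefl b (hηs (subset_tsupport η hne)).2
  have hη' : Continuous (deriv η) := hη.continuous_deriv (by simp)
  have := intervalIntegral.integral_mul_deriv_eq_deriv_mul (a := a) (b := b)
    (fun x _ ↦ hu x) (fun x _ ↦ (hη.differentiable (by simp) x).hasDerivAt)
    (hg.intervalIntegrable _ _) (hη'.intervalIntegrable _ _)
  simp only [hηa, hηb, intervalIntegral.integral_of_le hab, integral_Ioc_eq_integral_Ioo,
    mul_zero, sub_zero, zero_sub] at this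
  exact this

lemma hasWeakDerivOn_univ_of_hasDerivAt {u g : ℝ → ℝ}
    (hu : ∀ x, HasDerivAt u (g x) x) (hg : Continuous g) : HasWeakDerivOn univ u g := by
  intro η hη hηc _
  obtain ⟨R, hR⟩ := hηc.isCompact.isBounded.subset_closedBall 0
  have hsub : tsupport η ⊆ Ioo (-(|R| + 1)) (|R| + 1) := fun x hx ↦ by
    have := hR hx
    rw [mem_closedBall_zero_iff, Real.norm_eq_abs] at this
    exact abs_lt.1 (this.trans_lt ((le_abs_self R).trans_lt (lt_add_one _)))
  have h1 := hasWeakDerivOn_Ioo_of_hasDerivAt (a := -(|R| + 1)) (b := |R| + 1)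
    (by linarith [abs_nonneg R]) hu hg η hη hηc hsub
  rw [setIntegral_univ, setIntegral_univ]
  rwa [setIntegral_eq_integral_of_forall_compl_eq_zero,
    setIntegral_eq_integral_of_forall_compl_eq_zero] at h1
  · intro x hx
    have : η x = 0 := by
      by_contra hne
      exact hx (hsub (subset_tsupport η hne))
    simp [this]
  · intro x hx
    have : deriv η x = 0 := by
      by_contra hne
      exact hx (hsub (support_deriv_subset hne))
    simp [this]

/-! ### The sharp inequality on the line -/

lemma powNormOn_eq_ofReal_integral {I : Set ℝ} {p : ℕ} (hp : Even p) {f : ℝ → ℝ}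
    (hf : IntegrableOn (fun x ↦ f x ^ p) I) :
    powNormOn I p f = ENNReal.ofReal (∫ x in I, f x ^ p) := by
  rw [ofReal_integral_eq_lintegral_ofReal hf (Filter.Eventually.of_forall fun x ↦ hp.pow_nonneg _)]
  refine lintegral_congr fun x ↦ ?_
  rw [← hp.pow_abs, ENNReal.ofReal_pow (abs_nonneg _), ← Real.norm_eq_abs, ofReal_norm]

lemma IsH1On.integrable_mul {I : Set ℝ} {u g : ℝ → ℝ} (h : IsH1On I u g) :
    IntegrableOn (fun x ↦ u x * g x) I :=
  h.memLp.integrable_mul h.memLp_deriv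

lemma IsH1On.integrable_sq {I : Set ℝ} {u g : ℝ → ℝ} (h : IsH1On I u g) :
    IntegrableOn (fun x ↦ u x ^ 2) I :=
  h.memLp.integrable_sq

lemma IsH1On.integrable_deriv_sq {I : Set ℝ} {u g : ℝ → ℝ} (h : IsH1On I u g) :
    IntegrableOn (fun x ↦ g x ^ 2) I :=
  h.memLp_deriv.integrable_sq

/-- A square integrable function is arbitrarily small somewhere on any set of infinite measure. -/
lemma exists_abs_lt_of_integrable_sq {u : ℝ → ℝ} (hu : Integrable (fun x ↦ u x ^ 2))
    {s : Set ℝ} (hs : volume s = ⊤) {ε : ℝ} (hε : 0 < ε) : ∃ x ∈ s, |u x| < ε := by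
  by_contra! h
  refine (hu.measure_norm_ge_lt_top (ε := ε ^ 2) (by positivity)).ne (top_unique ?_)
  rw [← hs]
  refine measure_mono fun x hx ↦ ?_
  have := h x hx
  simp only [mem_ofPred_eq, norm_pow, Real.norm_eq_abs]
  gcongr

/-- If `Φ` vanishes at `0` and has derivative `F`, then integrating `(Φ ∘ u)'` from `-∞` to `x` and
from `x` to `∞` bounds `2 Φ (u x)` by the integral of `|F(u) u'|`. -/
lemma IsH1On.two_mul_comp_le {u g : ℝ → ℝ} (h : IsH1On univ u g) (hu : Continuous u)
    {Φ F : ℝ → ℝ} (hΦ : ∀ t, HasDerivAt Φ (F t) t) (hF : Continuous F) (hΦ0 : Φ 0 = 0)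
    (hint : Integrable (fun x ↦ F (u x) * g x)) (x : ℝ) :
    2 * Φ (u x) ≤ ∫ t, |F (u t) * g t| := by
  have hsq : Integrable (fun x ↦ u x ^ 2) := by simpa using h.integrable_sq
  refine le_of_forall_pos_le_add fun ε hε ↦ ?_
  obtain ⟨δ, hδ, hδε⟩ := Metric.continuousAt_iff.1 (hΦ 0).continuousAt (ε / 2) (by positivity)
  have hsmall : ∀ t, |t| < δ → Φ t ≤ ε / 2 := fun t ht ↦ by
    have := hδε (x := t) (by simpa [Real.dist_eq] using ht)
    rw [hΦ0, Real.dist_eq, sub_zero] at this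
    exact (le_abs_self _).trans this.le
  obtain ⟨y, hxy, hy⟩ := exists_abs_lt_of_integrable_sq hsq (Real.volume_Ioi (a := x)) hδ
  obtain ⟨z, hzx, hz⟩ := exists_abs_lt_of_integrable_sq hsq (Real.volume_Iio (a := x)) hδ
  rw [mem_Ioi] at hxy
  rw [mem_Iio] at hzx
  have hzy : z < y := hzx.trans hxy
  have hg : IntegrableOn g (Ioo z y) := by
    have := h.memLp_deriv.restrict (Ioo z y)
    rw [Measure.restrict_restrict measurableSet_Ioo, inter_univ] at this
    exact this.integrable (by norm_num)
  have hw : HasWeakDerivOn (Ioo z y) u g := h.weakDeriv.mono (subset_univ _) .univ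
  have hxm : x ∈ Icc z y := ⟨hzx.le, hxy.le⟩
  have e1 := hw.integral_comp_mul hzy hu.continuousOn hg hΦ hF (left_mem_Icc.2 hzy.le) hxm
  have e2 := hw.integral_comp_mul hzy hu.continuousOn hg hΦ hF hxm (right_mem_Icc.2 hzy.le)
  have b1 := intervalIntegral.abs_integral_le_integral_abs (μ := volume)
    (f := fun t ↦ F (u t) * g t) hzx.le
  have b2 := intervalIntegral.abs_integral_le_integral_abs (μ := volume)
    (f := fun t ↦ F (u t) * g t) hxy.le
  have b3 := intervalIntegral.integral_add_adjacent_intervals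
    (hint.abs.intervalIntegrable (a := z) (b := x)) (hint.abs.intervalIntegrable (a := x) (b := y))
  have b4 : ∫ t in z..y, |F (u t) * g t| ≤ ∫ t, |F (u t) * g t| := by
    rw [intervalIntegral.integral_of_le hzy.le]
    exact setIntegral_le_integral hint.abs (Filter.Eventually.of_forall fun t ↦ abs_nonneg _)
  have := hsmall _ hy
  have := hsmall _ hz
  have := le_abs_self (∫ t in z..x, F (u t) * g t)
  have := neg_abs_le (∫ t in x..y, F (u t) * g t)
  linarith

lemma IsH1On.bddAbove_range_abs {u g : ℝ → ℝ} (h : IsH1On univ u g) (hu : Continuous u) :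
    BddAbove (range fun x ↦ |u x|) := by
  have hi : Integrable (fun x ↦ 2 * u x * g x) := by
    simpa [mul_assoc] using h.integrable_mul.const_mul 2
  refine ⟨√((∫ t, |2 * u t * g t|) / 2), ?_⟩
  rintro _ ⟨x, rfl⟩
  have := h.two_mul_comp_le hu (Φ := fun t ↦ t ^ 2) (F := fun t ↦ 2 * t)
    (fun t ↦ by simpa using hasDerivAt_pow 2 t) (by fun_prop) (by simp) hi x
  exact Real.le_sqrt_of_sq_le (by rw [sq_abs]; linarith)

/-- The function `t √(M⁴ - t⁴)`: up to a factor, the solitons of height `M` are the solutions of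
`|u'| = F(u)`. -/
noncomputable def solitonSlope (M t : ℝ) : ℝ := t * √(M ^ 4 - t ^ 4)

/-- The primitive of `solitonSlope M` vanishing at `0`. -/
noncomputable def solitonPotential (M t : ℝ) : ℝ := ∫ s in (0 : ℝ)..t, solitonSlope M s

lemma continuous_solitonSlope (M : ℝ) : Continuous (solitonSlope M) := by
  unfold solitonSlope; fun_prop

lemma hasDerivAt_solitonPotential (M t : ℝ) :
    HasDerivAt (solitonPotential M) (solitonSlope M t) t :=
  intervalIntegral.integral_hasDerivAt_right ((continuous_solitonSlope M).intervalIntegrable _ _)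
    ((continuous_solitonSlope M).stronglyMeasurableAtFilter _ _)
    (continuous_solitonSlope M).continuousAt

lemma solitonPotential_neg (M t : ℝ) : solitonPotential M (-t) = solitonPotential M t := by
  have h1 := intervalIntegral.integral_comp_neg (a := 0) (b := t) (solitonSlope M)
  have h2 : ∀ x, solitonSlope M (-x) = -solitonSlope M x := fun x ↦ by
    simp [solitonSlope, (show Even 4 by decide).neg_pow]
  simp only [h2, neg_zero, intervalIntegral.integral_neg] at h1
  rw [solitonPotential, solitonPotential, intervalIntegral.integral_symm]
  linarith

lemma solitonPotential_abs (M t : ℝ) : solitonPotential M |t| = solitonPotential M t := by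
  rcases abs_choice t with h | h <;> rw [h]
  exact solitonPotential_neg M t

lemma solitonPotential_self {M : ℝ} (hM : 0 < M) : solitonPotential M M = Real.pi * M ^ 4 / 8 := by
  have hder : ∀ t ∈ Ioo 0 M, HasDerivAt
      (fun t ↦ (t ^ 2 * √(M ^ 4 - t ^ 4) + M ^ 4 * Real.arcsin (t ^ 2 / M ^ 2)) / 4)
      (solitonSlope M t) t := by
    intro t ht
    have h4 : 0 < M ^ 4 - t ^ 4 := sub_pos.2 (by gcongr; exacts [ht.1.le, ht.2])
    have hlt : t ^ 2 / M ^ 2 < 1 := by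
      rw [div_lt_one (by positivity)]
      gcongr; exacts [ht.1.le, ht.2]
    have hnn : 0 ≤ t ^ 2 / M ^ 2 := by positivity
    have hs : 0 < √(M ^ 4 - t ^ 4) := Real.sqrt_pos.2 h4
    have d1 := ((hasDerivAt_pow 4 t).const_sub (M ^ 4)).sqrt h4.ne'
    have d2 := (Real.hasDerivAt_arcsin (x := t ^ 2 / M ^ 2) (by linarith) hlt.ne).comp t
      ((hasDerivAt_pow 2 t).div_const (M ^ 2))
    have d := (((hasDerivAt_pow 2 t).mul d1).add (d2.const_mul (M ^ 4))).div_const 4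
    have hsq : √(1 - (t ^ 2 / M ^ 2) ^ 2) = √(M ^ 4 - t ^ 4) / M ^ 2 := by
      rw [show 1 - (t ^ 2 / M ^ 2) ^ 2 = (M ^ 4 - t ^ 4) / (M ^ 2) ^ 2 by field_simp,
        Real.sqrt_div h4.le, Real.sqrt_sq (by positivity)]
    have hss : √(M ^ 4 - t ^ 4) ^ 2 = M ^ 4 - t ^ 4 := Real.sq_sqrt h4.le
    refine d.congr_deriv ?_
    rw [hsq, solitonSlope]
    field_simp
    norm_num
    linear_combination (-4 * t) * hss
  have hcont : ContinuousOn
      (fun t ↦ (t ^ 2 * √(M ^ 4 - t ^ 4) + M ^ 4 * Real.arcsin (t ^ 2 / M ^ 2)) / 4) (Icc 0 M) := by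
    fun_prop
  rw [solitonPotential, intervalIntegral.integral_eq_sub_of_hasDerivAt_of_le hM.le hcont hder
    ((continuous_solitonSlope M).intervalIntegrable _ _)]
  simp [hM.ne']
  ring

/-- The critical Gagliardo–Nirenberg inequality on the line, with the optimal constant `4 / π²`.
With `M = sup |u|`, `F(t) = t √(M⁴ - t⁴)`, `Φ' = F` and `k = π / (2 ∫ u²)`, one has
`4 k Φ(M) ≤ 2 ∫ |k F(u) u'| ≤ ∫ u'² + k² ∫ F(u)²`, where `Φ(M) = π M⁴ / 8`; the terms with `M`
cancel. -/
lemma IsH1On.integral_pow_six_le {u g : ℝ → ℝ} (h : IsH1On univ u g) (hu : Continuous u) :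
    Integrable (fun x ↦ u x ^ 6) ∧
      ∫ x, u x ^ 6 ≤ 4 / Real.pi ^ 2 * (∫ x, u x ^ 2) ^ 2 * ∫ x, g x ^ 2 := by
  have hsq : Integrable (fun x ↦ u x ^ 2) := by simpa using h.integrable_sq
  have hgsq : Integrable (fun x ↦ g x ^ 2) := by simpa using h.integrable_deriv_sq
  have hug : Integrable (fun x ↦ u x * g x) := by simpa using h.integrable_mul
  have hgm : AEStronglyMeasurable g := by simpa using h.memLp_deriv.aestronglyMeasurable
  have hbdd := h.bddAbove_range_abs hu
  set M := ⨆ x, |u x|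
  have hle : ∀ x, |u x| ≤ M := fun x ↦ le_ciSup hbdd x
  have hle4 : ∀ x, u x ^ 4 ≤ M ^ 4 := fun x ↦ by
    rw [← (show Even 4 by decide).pow_abs]
    exact pow_le_pow_left₀ (abs_nonneg _) (hle x) 4
  have h6 : Integrable (fun x ↦ u x ^ 6) := by
    refine (hsq.const_mul (M ^ 4)).mono' (by fun_prop) (Filter.Eventually.of_forall fun x ↦ ?_)
    rw [Real.norm_eq_abs, abs_of_nonneg (by positivity), show u x ^ 6 = u x ^ 4 * u x ^ 2 by ring]
    exact mul_le_mul_of_nonneg_right (hle4 x) (sq_nonneg _)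
  refine ⟨h6, ?_⟩
  rcases (abs_nonneg (u 0)).trans (hle 0) |>.eq_or_lt with hM | hM
  · have hzero : ∀ x, u x = 0 := fun x ↦ abs_nonpos_iff.1 (hM ▸ hle x)
    simp [hzero]
  have hmpos : 0 < ∫ x, u x ^ 2 := by
    obtain ⟨x, hx⟩ := exists_lt_of_lt_ciSup hM
    exact integral_pos_of_integrable_nonneg_nonzero (hu.pow 2) hsq (fun x ↦ sq_nonneg _)
      (pow_ne_zero 2 (abs_pos.1 hx))
  set m := ∫ x, u x ^ 2
  set D := ∫ x, g x ^ 2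
  have hslope : ∀ x, solitonSlope M (u x) ^ 2 = M ^ 4 * u x ^ 2 - u x ^ 6 := fun x ↦ by
    rw [solitonSlope, mul_pow, Real.sq_sqrt (sub_nonneg.2 (hle4 x))]
    ring
  have hFg : Integrable (fun x ↦ solitonSlope M (u x) * g x) := by
    refine (hug.norm.const_mul (M ^ 2)).mono'
      (((continuous_solitonSlope M).comp hu).aestronglyMeasurable.mul hgm)
      (Filter.Eventually.of_forall fun x ↦ ?_)
    rw [norm_mul, norm_mul, ← mul_assoc]
    gcongr
    rw [solitonSlope, norm_mul, mul_comm, Real.norm_of_nonneg (Real.sqrt_nonneg _)]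
    gcongr
    refine Real.sqrt_le_iff.2 ⟨by positivity, ?_⟩
    nlinarith [show 0 ≤ u x ^ 4 by positivity]
  set k := Real.pi / (2 * m)
  have hk : 0 < k := by positivity
  -- completing the square
  have hyoung : 2 * k * ∫ x, |solitonSlope M (u x) * g x|
      ≤ D + k ^ 2 * (M ^ 4 * m - ∫ x, u x ^ 6) := by
    have hr : Integrable (fun x ↦ k ^ 2 * (M ^ 4 * u x ^ 2 - u x ^ 6)) :=
      ((hsq.const_mul _).sub h6).const_mul _
    rw [← integral_const_mul, ← integral_const_mul, ← integral_sub (hsq.const_mul _) h6,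
      ← integral_const_mul, ← integral_add hgsq hr]
    refine integral_mono (hFg.abs.const_mul _) (hgsq.add hr) fun x ↦ ?_
    change 2 * k * |solitonSlope M (u x) * g x| ≤ g x ^ 2 + k ^ 2 * (M ^ 4 * u x ^ 2 - u x ^ 6)
    rw [← hslope, abs_mul, ← sq_abs (g x), ← sq_abs (solitonSlope M (u x))]
    nlinarith [sq_nonneg (|g x| - k * |solitonSlope M (u x)|)]
  -- the supremum `M` need not be attained: pass to the limit along a maximizing sequence
  have hpot : 2 * solitonPotential M M ≤ ∫ x, |solitonSlope M (u x) * g x| := by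
    obtain ⟨v, -, hv, hvr⟩ := exists_seq_tendsto_sSup (range_nonempty fun x ↦ |u x|) hbdd
    choose x hx using hvr
    have hcont : Continuous (solitonPotential M) :=
      continuous_iff_continuousAt.2 fun t ↦ (hasDerivAt_solitonPotential M t).continuousAt
    refine le_of_tendsto (((hcont.tendsto M).comp hv).const_mul 2)
      (Filter.Eventually.of_forall fun n ↦ ?_)
    simp only [Function.comp, ← hx, solitonPotential_abs]
    exact h.two_mul_comp_le hu (hasDerivAt_solitonPotential M) (continuous_solitonSlope M)
      (by simp [solitonPotential]) hFg _
  rw [solitonPotential_self hM] at hpot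
  have hfin := (mul_le_mul_of_nonneg_left hpot (by positivity : 0 ≤ 2 * k)).trans hyoung
  have hkm : k * m = Real.pi / 2 := by simp only [k]; field_simp
  have : k ^ 2 * ∫ x, u x ^ 6 ≤ D := by
    have : 2 * k * (2 * (Real.pi * M ^ 4 / 8)) = k ^ 2 * (M ^ 4 * m) := by
      linear_combination (-k * M ^ 4) * hkm
    linarith
  rw [mul_comm, ← le_div_iff₀ (by positivity)] at this
  refine this.trans_eq ?_
  simp only [k]
  field_simp
  norm_num

lemma lineGNConst_le : lineGNConst ≤ ENNReal.ofReal (4 / Real.pi ^ 2) := by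
  refine sInf_le fun u g hu h ↦ ?_
  obtain ⟨h6, hle⟩ := h.integral_pow_six_le hu
  rw [powNormOn_eq_ofReal_integral (by decide) (by simpa using h6),
    powNormOn_eq_ofReal_integral even_two h.integrable_sq,
    powNormOn_eq_ofReal_integral even_two h.integrable_deriv_sq, setIntegral_univ, setIntegral_univ,
    setIntegral_univ, ← ENNReal.ofReal_pow (by positivity), ← ENNReal.ofReal_mul (by positivity),
    ← ENNReal.ofReal_mul (by positivity)]
  exact ENNReal.ofReal_le_ofReal hle

/-- A nonzero test function bounds the optimal constant on the line away from `0`. -/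
lemma lineGNConst_pos : 0 < lineGNConst := by
  let φ : ContDiffBump (0 : ℝ) := ⟨1, 2, by norm_num, by norm_num⟩
  have hφ : ContDiff ℝ 1 φ := φ.contDiff
  have hc : HasCompactSupport φ := φ.hasCompactSupport
  have hd : Continuous (deriv φ) := hφ.continuous_deriv le_rfl
  have hint : ∀ p : ℕ, p ≠ 0 → Integrable (fun x ↦ φ x ^ p) := fun p hp ↦
    (hφ.continuous.pow p).integrable_of_hasCompactSupport (hc.comp_left (g := (· ^ p)) (zero_pow hp))
  have h : IsH1On univ φ (deriv φ) :=
    { memLp := hφ.continuous.memLp_of_hasCompactSupport hc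
      memLp_deriv := hd.memLp_of_hasCompactSupport hc.deriv
      weakDeriv := hasWeakDerivOn_univ_of_hasDerivAt
        (fun x ↦ (hφ.differentiable one_ne_zero x).hasDerivAt) hd }
  have hS : powNormOn univ 6 φ ≠ 0 := by
    rw [powNormOn_eq_ofReal_integral (by decide) (by simpa using hint 6 (by norm_num)),
      setIntegral_univ, Ne, ENNReal.ofReal_eq_zero, not_le]
    refine (hφ.continuous.pow 6).integral_pos_of_hasCompactSupport_nonneg_nonzero
      (hc.comp_left (g := (· ^ 6)) (by norm_num)) (fun x ↦ by positivity) (x := 0) ?_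
    rw [φ.one_of_mem_closedBall (by simp [φ.rIn_pos.le])]
    norm_num
  have hm : powNormOn univ 2 φ ≠ ⊤ := by
    rw [powNormOn_eq_ofReal_integral even_two h.integrable_sq]; simp
  have hD : powNormOn univ 2 (deriv φ) ≠ ⊤ := by
    rw [powNormOn_eq_ofReal_integral even_two h.integrable_deriv_sq]; simp
  have hmD : powNormOn univ 2 φ ^ 2 * powNormOn univ 2 (deriv φ) ≠ ⊤ := by finiteness
  refine lt_of_lt_of_le (b := powNormOn univ 6 φ /
    (powNormOn univ 2 φ ^ 2 * powNormOn univ 2 (deriv φ))) (ENNReal.div_pos hS hmD) ?_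
  refine le_sInf fun C hC ↦ ENNReal.div_le_of_le_mul ?_
  rw [← mul_assoc]
  exact hC _ _ hφ.continuous h

/-! ### Finiteness of the optimal constant of the signpost graph -/

/-- The oscillation of `u²` on an edge is controlled by `∫ |u u'|`. -/
lemma IsH1On.sq_le_sq_add {l : ℝ} (hl : 0 < l) {u g : ℝ → ℝ} (h : IsH1On (Ioo 0 l) u g)
    (hu : ContinuousOn u (Icc 0 l)) {x y : ℝ} (hx : x ∈ Icc 0 l) (hy : y ∈ Icc 0 l) :
    u x ^ 2 ≤ u y ^ 2 + 2 * ∫ t in Ioo 0 l, |u t * g t| := by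
  have hg : IntegrableOn g (Ioo 0 l) := h.memLp_deriv.integrable (by norm_num)
  have e := h.weakDeriv.integral_comp_mul hl hu hg (Φ := fun t ↦ t ^ 2) (F := fun t ↦ 2 * t)
    (fun t ↦ by simpa using hasDerivAt_pow 2 t) (by fun_prop) hy hx
  simp only [mul_assoc, intervalIntegral.integral_const_mul] at e
  have b : |∫ t in y..x, u t * g t| ≤ ∫ t in Ioo 0 l, |u t * g t| := by
    rw [← integral_Ioc_eq_integral_Ioo]
    refine (intervalIntegral.norm_integral_le_integral_norm_uIoc (f := fun t ↦ u t * g t)).trans ?_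
    refine setIntegral_mono_set ?_ (Filter.Eventually.of_forall fun t ↦ abs_nonneg _)
      (Filter.Eventually.of_forall ?_)
    · exact (integrableOn_Ioc_iff_integrableOn_Ioo (f := fun t ↦ |u t * g t|)).2
        h.integrable_mul.abs
    · exact Ioc_subset_Ioc (le_min hy.1 hx.1) (max_le hy.2 hx.2)
  have := le_abs_self (∫ t in y..x, u t * g t)
  linarith

/-- The value of `u²` at a point is controlled by its mean over the edge and by `∫ |u u'|`. -/
lemma IsH1On.mul_sq_le {l : ℝ} (hl : 0 < l) {u g : ℝ → ℝ} (h : IsH1On (Ioo 0 l) u g)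
    (hu : ContinuousOn u (Icc 0 l)) {x : ℝ} (hx : x ∈ Icc 0 l) :
    l * u x ^ 2 ≤ (∫ t in Ioo 0 l, u t ^ 2) + l * (2 * ∫ t in Ioo 0 l, |u t * g t|) := by
  have hc : ∀ c : ℝ, ∫ _ in Ioo 0 l, c = l * c := fun c ↦ by simp [hl.le]
  rw [← hc, ← hc, ← integral_add h.integrable_sq (integrableOn_const (by simp))]
  refine setIntegral_mono_on (integrableOn_const (by simp))
    (h.integrable_sq.add (integrableOn_const (by simp))) measurableSet_Ioo fun y hy ↦ ?_
  exact h.sq_le_sq_add hl hu hx (Ioo_subset_Icc_self hy)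

namespace MetricGraph

variable {G : MetricGraph} {u g : G.E → ℝ → ℝ}

lemma summable_integral_sq_of_powNorm_lt_top
    (hu : ∀ e, IntegrableOn (fun x ↦ u e x ^ 2) (Ioo 0 (G.len e))) (h : G.powNorm 2 u < ⊤) :
    Summable fun e ↦ ∫ x in Ioo 0 (G.len e), u e x ^ 2 := by
  simp only [powNorm, fun e ↦ powNormOn_eq_ofReal_integral even_two (hu e)] at h
  refine (ENNReal.summable_toReal h.ne).congr fun e ↦ ENNReal.toReal_ofReal ?_
  exact integral_nonneg fun x ↦ sq_nonneg _

lemma powNorm_two_eq_ofReal_tsum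
    (hu : ∀ e, IntegrableOn (fun x ↦ u e x ^ 2) (Ioo 0 (G.len e))) (h : G.powNorm 2 u < ⊤) :
    G.powNorm 2 u = ENNReal.ofReal (∑' e, ∫ x in Ioo 0 (G.len e), u e x ^ 2) := by
  rw [ENNReal.ofReal_tsum_of_nonneg (fun e ↦ integral_nonneg fun x ↦ sq_nonneg _)
    (summable_integral_sq_of_powNorm_lt_top hu h)]
  exact tsum_congr fun e ↦ powNormOn_eq_ofReal_integral even_two (hu e)

lemma IsH1.summable_sq (h : G.IsH1 u g) : Summable fun e ↦ ∫ x in Ioo 0 (G.len e), u e x ^ 2 :=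
  summable_integral_sq_of_powNorm_lt_top (fun e ↦ (h.edge e).integrable_sq) h.sq_lt_top

lemma IsH1.summable_deriv_sq (h : G.IsH1 u g) :
    Summable fun e ↦ ∫ x in Ioo 0 (G.len e), g e x ^ 2 :=
  summable_integral_sq_of_powNorm_lt_top (fun e ↦ (h.edge e).integrable_deriv_sq) h.sq_deriv_lt_top

lemma IsH1.two_mul_integral_abs_mul_le (h : G.IsH1 u g) (e : G.E) (t : ℝ) :
    2 * t * ∫ x in Ioo 0 (G.len e), |u e x * g e x| ≤
      t ^ 2 * (∫ x in Ioo 0 (G.len e), u e x ^ 2) + ∫ x in Ioo 0 (G.len e), g e x ^ 2 := by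
  have hu := (h.edge e).integrable_sq
  have hg := (h.edge e).integrable_deriv_sq
  rw [← integral_const_mul, ← integral_const_mul, ← integral_add (hu.const_mul _) hg]
  refine integral_mono ((h.edge e).integrable_mul.abs.const_mul _) ((hu.const_mul _).add hg)
    fun x ↦ ?_
  change 2 * t * |u e x * g e x| ≤ t ^ 2 * u e x ^ 2 + g e x ^ 2
  rw [abs_mul, ← sq_abs (u e x), ← sq_abs (g e x)]
  nlinarith [sq_nonneg (t * |u e x| - |g e x|)]

lemma IsH1.summable_abs_mul (h : G.IsH1 u g) :
    Summable fun e ↦ ∫ x in Ioo 0 (G.len e), |u e x * g e x| := by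
  refine (h.summable_sq.add h.summable_deriv_sq).of_nonneg_of_le
    (fun e ↦ integral_nonneg fun x ↦ abs_nonneg _) fun e ↦ ?_
  have h1 := h.two_mul_integral_abs_mul_le e 1
  have h2 : 0 ≤ ∫ x in Ioo 0 (G.len e), |u e x * g e x| := integral_nonneg fun x ↦ abs_nonneg _
  linarith

/-- The Cauchy–Schwarz inequality on a metric graph. -/
lemma IsH1.sq_tsum_abs_mul_le (h : G.IsH1 u g) :
    (∑' e, ∫ x in Ioo 0 (G.len e), |u e x * g e x|) ^ 2 ≤
      (∑' e, ∫ x in Ioo 0 (G.len e), u e x ^ 2) * ∑' e, ∫ x in Ioo 0 (G.len e), g e x ^ 2 := by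
  have key : ∀ t : ℝ, 0 ≤ (∑' e, ∫ x in Ioo 0 (G.len e), u e x ^ 2) * (t * t)
      + (-2 * ∑' e, ∫ x in Ioo 0 (G.len e), |u e x * g e x|) * t
      + ∑' e, ∫ x in Ioo 0 (G.len e), g e x ^ 2 := fun t ↦ by
    have := (h.summable_abs_mul.mul_left (2 * t)).tsum_le_tsum
      (fun e ↦ h.two_mul_integral_abs_mul_le e t)
      ((h.summable_sq.mul_left (t ^ 2)).add h.summable_deriv_sq)
    rw [tsum_mul_left, (h.summable_sq.mul_left (t ^ 2)).tsum_add h.summable_deriv_sq,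
      tsum_mul_left] at this
    linarith
  -- nonnegativity of a quadratic polynomial in `t` bounds its discriminant
  have := discrim_le_zero key
  rw [discrim] at this
  linarith

lemma IsH1.integral_abs_mul_le_tsum (h : G.IsH1 u g) (e : G.E) :
    ∫ x in Ioo 0 (G.len e), |u e x * g e x| ≤ ∑' e, ∫ x in Ioo 0 (G.len e), |u e x * g e x| :=
  h.summable_abs_mul.le_tsum e fun _ _ ↦ integral_nonneg fun _ ↦ abs_nonneg _

/-- At the origin of an infinite ray made of edges of equal length, `u²` is at most `2 ∫ |u u'|`:
the values of `u` at the vertices of the ray tend to `0`. -/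
lemma IsH1.sq_le_of_ray (h : G.IsH1 u g) {φ : ℕ → G.E} (hφ : φ.Injective) {δ : ℝ}
    (hlen : ∀ n, G.len (φ n) = δ) (hpath : ∀ n, G.tgt (φ n) = G.src (φ (n + 1))) :
    u (φ 0) 0 ^ 2 ≤ 2 * ∑' e, ∫ x in Ioo 0 (G.len e), |u e x * g e x| := by
  obtain ⟨val, hval⟩ := h.cont.2
  set W : G.E → ℝ := fun e ↦ ∫ x in Ioo 0 (G.len e), |u e x * g e x|
  set A : G.E → ℝ := fun e ↦ ∫ x in Ioo 0 (G.len e), u e x ^ 2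
  have hδ : 0 < δ := hlen 0 ▸ G.len_pos _
  have hW : Summable (fun n ↦ W (φ n)) := h.summable_abs_mul.comp_injective hφ
  have hA : Summable (fun n ↦ A (φ n)) := h.summable_sq.comp_injective hφ
  have hW0 : ∀ e, 0 ≤ W e := fun e ↦ integral_nonneg fun x ↦ abs_nonneg _
  have hstep : ∀ n, u (φ 0) 0 ^ 2 ≤ u (φ n) 0 ^ 2 + 2 * ∑ k ∈ Finset.range n, W (φ k) := by
    intro n
    induction n with
    | zero => simp
    | succ n ih =>
      have h1 := (h.edge (φ n)).sq_le_sq_add (G.len_pos _) (h.cont.1 _)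
        (left_mem_Icc.2 (G.len_pos _).le) (right_mem_Icc.2 (G.len_pos _).le)
      rw [(hval (φ n)).2, hpath n, ← (hval (φ (n + 1))).1] at h1
      rw [Finset.sum_range_succ]
      change _ ≤ _ + 2 * W (φ n) at h1
      linarith
  have hbound : ∀ n, u (φ 0) 0 ^ 2 ≤ (A (φ n) / δ + 2 * W (φ n)) + 2 * ∑' e, W e := by
    intro n
    have h1 := (h.edge (φ n)).mul_sq_le (G.len_pos _) (h.cont.1 _)
      (left_mem_Icc.2 (G.len_pos _).le)
    change G.len (φ n) * _ ≤ A (φ n) + G.len (φ n) * (2 * W (φ n)) at h1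
    rw [hlen n] at h1
    have h2 : u (φ n) 0 ^ 2 ≤ A (φ n) / δ + 2 * W (φ n) := by
      rw [div_add' _ _ _ hδ.ne', le_div_iff₀ hδ]
      linarith
    have h3 := hW.sum_le_tsum (Finset.range n) fun k _ ↦ hW0 _
    have h4 := tsum_comp_le_tsum_of_inj h.summable_abs_mul hW0 hφ
    have h5 : ∑' n, W (φ n) ≤ ∑' e, W e := h4
    linarith [hstep n]
  have hlim : Filter.Tendsto (fun n ↦ (A (φ n) / δ + 2 * W (φ n)) + 2 * ∑' e, W e) Filter.atTop
      (nhds ((0 / δ + 2 * 0) + 2 * ∑' e, W e)) :=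
    ((hA.tendsto_atTop_zero.div_const δ).add (hW.tendsto_atTop_zero.const_mul 2)).add_const _
  have := ge_of_tendsto' hlim hbound
  simpa using this

/-- A bound `sup u² ≤ c ∫ |u u'|`, valid on all of `H¹(G)`, implies the critical
Gagliardo–Nirenberg inequality. -/
lemma gnConst_le_of_sq_le {c : ℝ}
    (hsup : ∀ u g, G.IsH1 u g → ∀ e, ∀ x ∈ Icc 0 (G.len e),
      u e x ^ 2 ≤ c * ∑' e, ∫ x in Ioo 0 (G.len e), |u e x * g e x|) :
    G.gnConst ≤ ENNReal.ofReal (c ^ 2) := by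
  refine sInf_le fun u g h ↦ ?_
  set W := ∑' e, ∫ x in Ioo 0 (G.len e), |u e x * g e x|
  have h6 : G.powNorm 6 u ≤ ENNReal.ofReal ((c * W) ^ 2) * G.powNorm 2 u := by
    rw [powNorm, powNorm, ← ENNReal.tsum_mul_left]
    refine ENNReal.tsum_le_tsum fun e ↦ ?_
    rw [powNormOn, powNormOn, ← lintegral_const_mul' _ _ ENNReal.ofReal_ne_top]
    refine setLIntegral_mono_ae' measurableSet_Ioo (Filter.Eventually.of_forall fun x hx ↦ ?_)
    have h1 := hsup u g h e x (Ioo_subset_Icc_self hx)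
    rw [show 6 = 4 + 2 from rfl, pow_add]
    gcongr
    rw [← ofReal_norm, ← ENNReal.ofReal_pow (norm_nonneg _)]
    refine ENNReal.ofReal_le_ofReal ?_
    rw [Real.norm_eq_abs, (show Even 4 by decide).pow_abs, show u e x ^ 4 = (u e x ^ 2) ^ 2 by ring]
    gcongr
  refine h6.trans ?_
  have hA : 0 ≤ ∑' e, ∫ x in Ioo 0 (G.len e), u e x ^ 2 :=
    tsum_nonneg fun e ↦ integral_nonneg fun x ↦ sq_nonneg _
  have hB : 0 ≤ ∑' e, ∫ x in Ioo 0 (G.len e), g e x ^ 2 :=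
    tsum_nonneg fun e ↦ integral_nonneg fun x ↦ sq_nonneg _
  rw [powNorm_two_eq_ofReal_tsum (fun e ↦ (h.edge e).integrable_sq) h.sq_lt_top,
    powNorm_two_eq_ofReal_tsum (fun e ↦ (h.edge e).integrable_deriv_sq) h.sq_deriv_lt_top,
    ← ENNReal.ofReal_pow hA, ← ENNReal.ofReal_mul (by positivity),
    ← ENNReal.ofReal_mul (by positivity), ← ENNReal.ofReal_mul (by positivity)]
  refine ENNReal.ofReal_le_ofReal ?_
  have := mul_le_mul_of_nonneg_left h.sq_tsum_abs_mul_le (mul_nonneg (sq_nonneg c) hA)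
  nlinarith

end MetricGraph

/-- Every point of the signpost graph is joined by at most two edges to a vertex of the horizontal
line, hence to infinity. -/
lemma signpostGraph_gnConst_lt_top (circ vert horiz : ℝ) (hc : 0 < circ) (hv : 0 < vert)
    (hh : 0 < horiz) : (signpostGraph circ vert horiz hc hv hh).gnConst < ⊤ := by
  let G := signpostGraph circ vert horiz hc hv hh
  refine (G.gnConst_le_of_sq_le (c := 6) ?_).trans_lt ENNReal.ofReal_lt_top
  intro u g h e x hx
  set W := ∑' e, ∫ x in Ioo 0 (G.len e), |u e x * g e x|
  obtain ⟨val, hval⟩ := h.cont.2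
  have hstep : ∀ (e : G.E) (x y : ℝ), x ∈ Icc 0 (G.len e) → y ∈ Icc 0 (G.len e) →
      u e x ^ 2 ≤ u e y ^ 2 + 2 * W := fun e x y hx hy ↦ by
    have := (h.edge e).sq_le_sq_add (G.len_pos e) (h.cont.1 e) hx hy
    linarith [h.integral_abs_mul_le_tsum e]
  have hbase : ∀ i : ℤ, val (Quot.mk _ (i, SignpostVertex.base)) ^ 2 ≤ 2 * W := fun i ↦ by
    let φ : ℕ → G.E := fun n ↦ (i + n, SignpostEdge.horizontal)
    have hφ : φ.Injective := fun m n hmn ↦ by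
      have := (Prod.mk.inj hmn).1
      omega
    have := h.sq_le_of_ray hφ (δ := horiz) (fun n ↦ rfl) (fun n ↦ by
      have := Quot.sound (PeriodicityCell.Glue.paste
        (K := signpostCell circ vert horiz hc hv hh) (i + n) ⟨SignpostVertex.next, rfl⟩)
      refine this.trans ?_
      change Quot.mk _ (i + n + 1, SignpostVertex.base)
        = Quot.mk _ (i + (n + 1 : ℕ), SignpostVertex.base)
      push_cast
      rw [add_assoc])
    rw [(hval (φ 0)).1] at this
    have e0 : G.src (φ 0) = Quot.mk _ (i, SignpostVertex.base) := by
      change Quot.mk _ (i + ((0 : ℕ) : ℤ), SignpostVertex.base) = _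
      simp
    rwa [e0] at this
  have hW : 0 ≤ W := tsum_nonneg fun e ↦ integral_nonneg fun x ↦ abs_nonneg _
  have hl : ∀ e, (0 : ℝ) ∈ Icc 0 (G.len e) := fun e ↦ left_mem_Icc.2 (G.len_pos e).le
  have hr : ∀ e, G.len e ∈ Icc 0 (G.len e) := fun e ↦ right_mem_Icc.2 (G.len_pos e).le
  obtain ⟨i, _ | _ | _⟩ := e
  · let e : G.E := (i, .circle)
    let f : G.E := (i, .vertical)
    have h1 := hstep e x 0 hx (hl e)
    have h2 := hstep f (G.len f) 0 (hr f) (hl f)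
    rw [(hval e).1] at h1
    rw [(hval f).1, (hval f).2] at h2
    have h3 := hbase i
    change u e x ^ 2 ≤ val (Quot.mk _ (i, SignpostVertex.top)) ^ 2 + _ at h1
    change val (Quot.mk _ (i, SignpostVertex.top)) ^ 2
      ≤ val (Quot.mk _ (i, SignpostVertex.base)) ^ 2 + _ at h2
    change u e x ^ 2 ≤ _
    linarith
  · let f : G.E := (i, .vertical)
    have h2 := hstep f x 0 hx (hl f)
    rw [(hval f).1] at h2
    have h3 := hbase i
    change u f x ^ 2 ≤ val (Quot.mk _ (i, SignpostVertex.base)) ^ 2 + _ at h2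
    change u f x ^ 2 ≤ _
    linarith
  · let f : G.E := (i, .horizontal)
    have h2 := hstep f x 0 hx (hl f)
    rw [(hval f).1] at h2
    have h3 := hbase i
    change u f x ^ 2 ≤ val (Quot.mk _ (i, SignpostVertex.base)) ^ 2 + _ at h2
    change u f x ^ 2 ≤ _
    linarith

/-! ### A competitor on the signpost graph -/

lemma hasDerivAt_arctan_sinh (y : ℝ) :
    HasDerivAt (fun y ↦ Real.arctan (Real.sinh y)) (Real.cosh y)⁻¹ y := by
  refine (Real.hasDerivAt_sinh y).arctan.congr_deriv ?_
  have := Real.cosh_pos y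
  rw [add_comm, ← Real.cosh_sq]
  field_simp

lemma hasDerivAt_sinh_div_cosh_sq (y : ℝ) :
    HasDerivAt (fun y ↦ Real.sinh y / Real.cosh y ^ 2)
      (2 * (Real.cosh y)⁻¹ ^ 3 - (Real.cosh y)⁻¹) y := by
  have := Real.cosh_pos y
  refine ((Real.hasDerivAt_sinh y).div ((Real.hasDerivAt_cosh y).pow 2)
    (pow_ne_zero 2 this.ne')).congr_deriv ?_
  have h := Real.cosh_sq y
  field_simp
  norm_num
  linear_combination (2 * Real.cosh y ^ 4) * h

/-- The profile of the soliton centred at `z`, at the length scale `ε`, of height `1`. -/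
noncomputable def soliton (ε z x : ℝ) : ℝ := (√(Real.cosh ((x - z) / ε)))⁻¹

/-- The derivative of `soliton ε z`. -/
noncomputable def solitonDeriv (ε z x : ℝ) : ℝ :=
  -(Real.sinh ((x - z) / ε) / (2 * ε * Real.cosh ((x - z) / ε)) * soliton ε z x)

lemma continuous_soliton (ε z : ℝ) : Continuous (soliton ε z) := by
  unfold soliton
  exact (by fun_prop : Continuous fun x ↦ √(Real.cosh ((x - z) / ε))).inv₀
    fun x ↦ (Real.sqrt_pos.2 (Real.cosh_pos _)).ne'

lemma soliton_sq (ε z x : ℝ) : soliton ε z x ^ 2 = (Real.cosh ((x - z) / ε))⁻¹ := by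
  rw [soliton, inv_pow, Real.sq_sqrt (Real.cosh_pos _).le]

lemma continuous_solitonDeriv {ε : ℝ} (hε : 0 < ε) (z : ℝ) : Continuous (solitonDeriv ε z) := by
  unfold solitonDeriv
  refine (Continuous.mul ?_ (continuous_soliton ε z)).neg
  exact Continuous.div (by fun_prop) (by fun_prop)
    fun x ↦ (mul_pos (by positivity) (Real.cosh_pos _)).ne'

lemma hasDerivAt_soliton {ε : ℝ} (hε : 0 < ε) (z x : ℝ) :
    HasDerivAt (soliton ε z) (solitonDeriv ε z x) x := by
  have hpos := Real.cosh_pos ((x - z) / ε)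
  have hs : 0 < √(Real.cosh ((x - z) / ε)) := Real.sqrt_pos.2 hpos
  have d := ((((hasDerivAt_id x).sub_const z).div_const ε).cosh.sqrt hpos.ne').inv hs.ne'
  refine d.congr_deriv ?_
  rw [solitonDeriv, soliton]
  have hsq : √(Real.cosh ((x - z) / ε)) ^ 2 = Real.cosh ((x - z) / ε) := Real.sq_sqrt hpos.le
  simp only [id]
  rw [hsq]
  field_simp

/-- The integrals of `u²`, `u⁶` and `u'²` of a soliton `u` are computed on the interval of length
`2 ε L` around its centre, where the truncated soliton lives. -/
lemma integral_soliton_sq {ε : ℝ} (hε : 0 < ε) (z : ℝ) (L : ℝ) :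
    ∫ x in (z - ε * L)..(z + ε * L), soliton ε z x ^ 2 = ε * (2 * Real.arctan (Real.sinh L)) := by
  have hd : ∀ x ∈ uIcc (z - ε * L) (z + ε * L),
      HasDerivAt (fun x ↦ ε * Real.arctan (Real.sinh ((x - z) / ε))) (soliton ε z x ^ 2) x := by
    intro x _
    refine (((hasDerivAt_arctan_sinh ((x - z) / ε)).comp x
      (((hasDerivAt_id x).sub_const z).div_const ε)).const_mul ε).congr_deriv ?_
    rw [soliton_sq]
    field_simp
  rw [intervalIntegral.integral_eq_sub_of_hasDerivAt hd
    (((continuous_soliton ε z).pow 2).intervalIntegrable _ _)]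
  have e1 : (z + ε * L - z) / ε = L := by field_simp; ring
  have e2 : (z - ε * L - z) / ε = -L := by field_simp; ring
  rw [e1, e2, Real.sinh_neg, Real.arctan_neg]
  ring

lemma integral_soliton_pow_six {ε : ℝ} (hε : 0 < ε) (z : ℝ) (L : ℝ) :
    ∫ x in (z - ε * L)..(z + ε * L), soliton ε z x ^ 6 =
      ε * (Real.arctan (Real.sinh L) + Real.sinh L / Real.cosh L ^ 2) := by
  have hd : ∀ x ∈ uIcc (z - ε * L) (z + ε * L),
      HasDerivAt (fun x ↦ ε / 2 * (Real.arctan (Real.sinh ((x - z) / ε))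
        + Real.sinh ((x - z) / ε) / Real.cosh ((x - z) / ε) ^ 2)) (soliton ε z x ^ 6) x := by
    intro x _
    refine ((((hasDerivAt_arctan_sinh ((x - z) / ε)).add
      (hasDerivAt_sinh_div_cosh_sq ((x - z) / ε))).comp x
      (((hasDerivAt_id x).sub_const z).div_const ε)).const_mul (ε / 2)).congr_deriv ?_
    rw [show soliton ε z x ^ 6 = (soliton ε z x ^ 2) ^ 3 by ring, soliton_sq]
    field_simp
    ring
  rw [intervalIntegral.integral_eq_sub_of_hasDerivAt hd
    (((continuous_soliton ε z).pow 6).intervalIntegrable _ _)]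
  have e1 : (z + ε * L - z) / ε = L := by field_simp; ring
  have e2 : (z - ε * L - z) / ε = -L := by field_simp; ring
  rw [e1, e2, Real.sinh_neg, Real.arctan_neg, Real.cosh_neg]
  ring

lemma integral_solitonDeriv_sq {ε : ℝ} (hε : 0 < ε) (z : ℝ) (L : ℝ) :
    ∫ x in (z - ε * L)..(z + ε * L), solitonDeriv ε z x ^ 2 =
      1 / (4 * ε) * (Real.arctan (Real.sinh L) - Real.sinh L / Real.cosh L ^ 2) := by
  have hd : ∀ x ∈ uIcc (z - ε * L) (z + ε * L),
      HasDerivAt (fun x ↦ 1 / (8 * ε) * (Real.arctan (Real.sinh ((x - z) / ε))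
        - Real.sinh ((x - z) / ε) / Real.cosh ((x - z) / ε) ^ 2)) (solitonDeriv ε z x ^ 2) x := by
    intro x _
    refine ((((hasDerivAt_arctan_sinh ((x - z) / ε)).sub
      (hasDerivAt_sinh_div_cosh_sq ((x - z) / ε))).comp x
      (((hasDerivAt_id x).sub_const z).div_const ε)).const_mul (1 / (8 * ε))).congr_deriv ?_
    have := Real.cosh_pos ((x - z) / ε)
    rw [solitonDeriv, neg_sq, mul_pow, soliton_sq, div_pow, Real.sinh_sq]
    field_simp
    ring
  rw [intervalIntegral.integral_eq_sub_of_hasDerivAt hd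
    (((continuous_solitonDeriv hε z).pow 2).intervalIntegrable _ _)]
  have e1 : (z + ε * L - z) / ε = L := by field_simp; ring
  have e2 : (z - ε * L - z) / ε = -L := by field_simp; ring
  rw [e1, e2, Real.sinh_neg, Real.arctan_neg, Real.cosh_neg]
  ring

lemma IsH1On.of_hasDerivAt {l : ℝ} (hl : 0 ≤ l) {u g : ℝ → ℝ} (hu : ∀ x, HasDerivAt u (g x) x)
    (hg : Continuous g) : IsH1On (Ioo 0 l) u g := by
  have hL : ∀ f : ℝ → ℝ, Continuous f → MemLp f 2 (volume.restrict (Ioo 0 l)) := fun f hf ↦ by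
    refine (memLp_two_iff_integrable_sq hf.aestronglyMeasurable).2 ?_
    exact ((hf.pow 2).integrableOn_Icc).mono_set Ioo_subset_Icc_self
  have huc : Continuous u := continuous_iff_continuousAt.2 fun x ↦ (hu x).continuousAt
  exact ⟨hL u huc, hL g hg, hasWeakDerivOn_Ioo_of_hasDerivAt hl hu hg⟩

lemma powNormOn_Ioo_eq_ofReal_intervalIntegral {l : ℝ} (hl : 0 ≤ l) {p : ℕ} (hp : Even p)
    {f : ℝ → ℝ} (hf : Continuous f) :
    powNormOn (Ioo 0 l) p f = ENNReal.ofReal (∫ x in (0 : ℝ)..l, f x ^ p) := by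
  rw [powNormOn_eq_ofReal_integral hp
    ((hf.pow p).integrableOn_Icc.mono_set Ioo_subset_Icc_self),
    intervalIntegral.integral_of_le hl, integral_Ioc_eq_integral_Ioo]

/-- A function with a large Gagliardo–Nirenberg quotient bounds the optimal constant from below. -/
lemma MetricGraph.ofReal_lt_gnConst {G : MetricGraph} {u g : G.E → ℝ → ℝ} (h : G.IsH1 u g)
    {C m D S : ℝ} (hm0 : 0 < m) (hD0 : 0 < D) (hm : G.powNorm 2 u = ENNReal.ofReal m)
    (hD : G.powNorm 2 g = ENNReal.ofReal D) (hS : ENNReal.ofReal S ≤ G.powNorm 6 u)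
    (hS0 : 0 < S) (hC : C * (m ^ 2 * D) < S) : ENNReal.ofReal C < G.gnConst := by
  have hmD : 0 < m ^ 2 * D := by positivity
  refine lt_of_lt_of_le (b := ENNReal.ofReal (S / (m ^ 2 * D))) ?_ (le_sInf fun K hK ↦ ?_)
  · rw [ENNReal.ofReal_lt_ofReal_iff (by positivity), lt_div_iff₀ hmD]
    exact hC
  · rw [ENNReal.ofReal_div_of_pos hmD]
    refine ENNReal.div_le_of_le_mul (hS.trans ((hK u g h).trans_eq ?_))
    rw [hm, hD, ENNReal.ofReal_mul (by positivity), ENNReal.ofReal_pow hm0.le, mul_assoc]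

/-- The function on the signpost graph, or its derivative, equal to `f` and `k` on the circle and
on the vertical edge of the copy `0` of the cell, and to `0` on all other edges. -/
def singleSignpost (f k : ℝ → ℝ) (e : ℤ × SignpostEdge) : ℝ → ℝ :=
  if e.1 = 0 then
    match e.2 with
    | .circle => f
    | .vertical => k
    | .horizontal => 0
  else 0

section singleSignpost

variable {circ vert horiz : ℝ} {hc : 0 < circ} {hv : 0 < vert} {hh : 0 < horiz}

lemma powNorm_singleSignpost {p : ℕ} (hp : p ≠ 0) (f k : ℝ → ℝ) :
    (signpostGraph circ vert horiz hc hv hh).powNorm p (singleSignpost f k) =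
      powNormOn (Ioo 0 circ) p f + powNormOn (Ioo 0 vert) p k := by
  classical
  have hzero : ∀ I, powNormOn I p 0 = 0 := fun I ↦ by simp [powNormOn, hp]
  have := tsum_eq_sum (L := SummationFilter.unconditional _) (f := fun e : ℤ × SignpostEdge ↦
    powNormOn (Ioo 0 ((signpostGraph circ vert horiz hc hv hh).len e)) p (singleSignpost f k e))
    (s := {(0, .circle), (0, .vertical)}) (by
      rintro ⟨i, e⟩ hie
      by_cases hi : i = 0
      · subst hi
        rcases e with _ | _ | _
        · simp at hie
        · simp at hie
        · exact hzero _
      · simp only [singleSignpost, hi, if_false]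
        exact hzero _)
  refine Eq.trans this ?_
  rw [Finset.sum_pair (by simp)]
  rfl

lemma isH1_singleSignpost {f f' k k' : ℝ → ℝ} (hf : ∀ x, HasDerivAt f (f' x) x)
    (hf' : Continuous f') (hk : ∀ x, HasDerivAt k (k' x) x) (hk' : Continuous k')
    (hloop : f 0 = f circ) (htop : k vert = f 0) (hbase : k 0 = 0) :
    (signpostGraph circ vert horiz hc hv hh).IsH1 (singleSignpost f k) (singleSignpost f' k') := by
  have hfc : Continuous f := continuous_iff_continuousAt.2 fun x ↦ (hf x).continuousAt
  have hkc : Continuous k := continuous_iff_continuousAt.2 fun x ↦ (hk x).continuousAt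
  have hcont : ∀ e, Continuous (singleSignpost f k e) := by
    rintro ⟨i, _ | _ | _⟩ <;> by_cases hi : i = 0 <;>
      simp only [singleSignpost, hi, if_true, if_false]
    exacts [hfc, continuous_zero, hkc, continuous_zero, continuous_zero, continuous_zero]
  have hcont' : ∀ e, Continuous (singleSignpost f' k' e) := by
    rintro ⟨i, _ | _ | _⟩ <;> by_cases hi : i = 0 <;>
      simp only [singleSignpost, hi, if_true, if_false]
    exacts [hf', continuous_zero, hk', continuous_zero, continuous_zero, continuous_zero]
  have hder : ∀ e x, HasDerivAt (singleSignpost f k e) (singleSignpost f' k' e x) x := by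
    rintro ⟨i, _ | _ | _⟩ x <;> by_cases hi : i = 0 <;>
      simp only [singleSignpost, hi, if_true, if_false]
    exacts [hf x, hasDerivAt_const x 0, hk x, hasDerivAt_const x 0, hasDerivAt_const x 0,
      hasDerivAt_const x 0]
  refine ⟨⟨fun e ↦ (hcont e).continuousOn, ?_⟩, fun e ↦ ?_, ?_, ?_⟩
  · let val : ℤ × SignpostVertex → ℝ := fun v ↦
      match v.2 with
      | .top => if v.1 = 0 then f 0 else 0
      | .base => 0
      | .next => 0
    refine ⟨Quot.lift val ?_, ?_⟩
    · rintro _ _ ⟨i, v, hvD⟩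
      obtain ⟨w, hw⟩ : ∃ w, w = (signpostCell circ vert horiz hc hv hh).σ ⟨v, hvD⟩ := ⟨_, rfl⟩
      rw [← hw]
      obtain ⟨w, hwR⟩ := w
      obtain rfl : v = SignpostVertex.next := hvD
      obtain rfl : w = SignpostVertex.base := hwR
      rfl
    · rintro ⟨i, e⟩
      by_cases hi : i = 0
      · subst hi
        rcases e with _ | _ | _
        · exact ⟨rfl, hloop.symm⟩
        · exact ⟨hbase, htop⟩
        · exact ⟨rfl, rfl⟩
      · rcases e with _ | _ | _
        · change singleSignpost f k (i, .circle) 0 = (if i = 0 then f 0 else 0) ∧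
            singleSignpost f k (i, .circle) circ = (if i = 0 then f 0 else 0)
          simp [singleSignpost, hi]
        · change singleSignpost f k (i, .vertical) 0 = 0 ∧
            singleSignpost f k (i, .vertical) vert = (if i = 0 then f 0 else 0)
          simp [singleSignpost, hi]
        · change singleSignpost f k (i, .horizontal) 0 = 0 ∧
            singleSignpost f k (i, .horizontal) horiz = 0
          simp [singleSignpost, hi]
  · exact IsH1On.of_hasDerivAt (MetricGraph.len_pos _ e).le (hder e) (hcont' e)
  · rw [powNorm_singleSignpost two_ne_zero,
      powNormOn_Ioo_eq_ofReal_intervalIntegral hc.le even_two hfc,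
      powNormOn_Ioo_eq_ofReal_intervalIntegral hv.le even_two hkc]
    finiteness
  · rw [powNorm_singleSignpost two_ne_zero,
      powNormOn_Ioo_eq_ofReal_intervalIntegral hc.le even_two hf',
      powNormOn_Ioo_eq_ofReal_intervalIntegral hv.le even_two hk']
    finiteness

end singleSignpost

/-- A bound for the Gagliardo–Nirenberg quotient of the competitor, in terms of the angle `α` with
`sin α = 1 / cosh L`, where `L` is half the rescaled length of the circle. To first order in `α`,
cutting the tails of the soliton and adding the single tail on the vertical edge decreases the
mass and the kinetic energy, but the integral of the sixth power changes only at order `α³`. -/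
lemma four_mul_sq_mul_lt {α : ℝ} (h0 : 0 < α) (h1 : α ≤ 1 / 2) :
    4 * (Real.pi - 2 * α + Real.sin α) ^ 2 *
        ((Real.pi / 2 - α - Real.sin α * Real.cos α) / 4 + Real.sin α / 3) <
      Real.pi ^ 2 * (Real.pi / 2 - α + Real.sin α * Real.cos α) := by
  have hpi := Real.pi_gt_three
  have hs : Real.sin α < α := Real.sin_lt h0
  have hs0 : 0 < Real.sin α := Real.sin_pos_of_pos_of_lt_pi h0 (by linarith)
  have h2 : α - α ^ 3 < Real.sin α * Real.cos α := by
    have := Real.sin_gt_sub_cube (x := 2 * α) (by linarith)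
    rw [Real.sin_two_mul] at this
    have : 0 < α ^ 3 := by positivity
    linarith
  have hα3 : α ^ 3 ≤ α / 4 := by nlinarith [mul_pos h0 h0]
  have hD : (Real.pi / 2 - α - Real.sin α * Real.cos α) / 4 + Real.sin α / 3 ≤ Real.pi / 8 := by
    linarith
  have hm : (Real.pi - 2 * α + Real.sin α) ^ 2 ≤ (Real.pi - α) ^ 2 := by
    gcongr
    · linarith
    · linarith
  have hmD : 4 * (Real.pi - 2 * α + Real.sin α) ^ 2 *
        ((Real.pi / 2 - α - Real.sin α * Real.cos α) / 4 + Real.sin α / 3) ≤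
      4 * (Real.pi - α) ^ 2 * (Real.pi / 8) := by
    calc _ ≤ 4 * (Real.pi - 2 * α + Real.sin α) ^ 2 * (Real.pi / 8) := by gcongr
      _ ≤ _ := by gcongr
  refine hmD.trans_lt ?_
  have h3 : Real.pi ^ 2 * (Real.pi / 2 - α ^ 3) <
      Real.pi ^ 2 * (Real.pi / 2 - α + Real.sin α * Real.cos α) := by
    gcongr
    linarith
  refine lt_trans ?_ h3
  have h4 : Real.pi ^ 2 * α ^ 3 ≤ Real.pi ^ 2 * (α / 4) := by gcongr
  have h5 : Real.pi * α ^ 2 ≤ Real.pi * (α / 2) := by gcongr; nlinarith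
  have h6 : 3 * (Real.pi * α) ≤ Real.pi * (Real.pi * α) := by gcongr
  nlinarith [mul_pos (mul_pos Real.pi_pos h0) Real.pi_pos]

/-- The competitor is a concentrated soliton on a circle, truncated at the ends of the circle and
continued by `c (x / vert) ^ n` on the vertical edge, at the length scale `ε = vert / (2 n)`. -/
lemma ofReal_lt_signpostGraph_gnConst (circ vert horiz : ℝ) (hc : 0 < circ) (hv : 0 < vert)
    (hh : 0 < horiz) :
    ENNReal.ofReal (4 / Real.pi ^ 2) < (signpostGraph circ vert horiz hc hv hh).gnConst := by
  -- `2 ≤ n` keeps the kinetic energy on the vertical edge below `sin α / (3 ε)`, and the second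
  -- condition says that the angle `α` is less than `1 / 2`
  obtain ⟨n, hn2, hn⟩ : ∃ n : ℕ, 2 ≤ n ∧
      Real.pi / 2 - 1 / 2 < Real.arctan (Real.sinh (circ / vert * n)) := by
    have h1 : Filter.Tendsto (fun n : ℕ ↦ circ / vert * (n : ℝ)) Filter.atTop Filter.atTop :=
      tendsto_natCast_atTop_atTop.const_mul_atTop (by positivity)
    have h2 : Filter.Tendsto Real.sinh Filter.atTop Filter.atTop :=
      Filter.tendsto_atTop_mono' _ ((Filter.eventually_ge_atTop 0).mono fun x hx ↦
        Real.self_le_sinh_iff.2 hx) Filter.tendsto_id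
    have h3 := (Real.tendsto_arctan_atTop.mono_right nhdsWithin_le_nhds).comp (h2.comp h1)
    have h4 := h3.eventually (lt_mem_nhds (show Real.pi / 2 - 1 / 2 < Real.pi / 2 by norm_num))
    obtain ⟨n, hn⟩ := ((Filter.eventually_ge_atTop 2).and h4).exists
    exact ⟨n, hn.1, hn.2⟩
  have hn0 : (2 : ℝ) ≤ n := by exact_mod_cast hn2
  set L := circ / vert * n
  have hL : 0 < L := by positivity
  set α := Real.pi / 2 - Real.arctan (Real.sinh L) with hαdef
  have hα0 : 0 < α := by linarith [Real.arctan_lt_pi_div_two (Real.sinh L)]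
  have hα1 : α ≤ 1 / 2 := by linarith
  have harctan : Real.arctan (Real.sinh L) = Real.pi / 2 - α := by rw [hαdef]; ring
  have hcosh := Real.cosh_pos L
  have hsqrt : √(1 + Real.sinh L ^ 2) = Real.cosh L := by
    rw [add_comm, ← Real.cosh_sq, Real.sqrt_sq hcosh.le]
  have hsin : Real.sin α = (Real.cosh L)⁻¹ := by
    rw [hαdef, Real.sin_pi_div_two_sub, Real.cos_arctan, hsqrt, one_div]
  have hcos : Real.cos α = Real.sinh L / Real.cosh L := by
    rw [hαdef, Real.cos_pi_div_two_sub, Real.sin_arctan, hsqrt]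
  have hsc : Real.sinh L / Real.cosh L ^ 2 = Real.sin α * Real.cos α := by
    rw [hsin, hcos]; field_simp
  set ε := vert / (2 * n) with hεdef
  have hε : 0 < ε := by positivity
  have hεL : ε * L = circ / 2 := by simp only [ε, L]; field_simp
  set z := circ / 2
  have hz1 : z - ε * L = 0 := by rw [hεL, sub_self]
  have hz2 : z + ε * L = circ := by rw [hεL]; simp only [z]; ring
  have hsym : soliton ε z 0 = soliton ε z circ := by
    rw [soliton, soliton, ← Real.cosh_neg]
    congr 3
    simp only [z]; ring
  have hc2 : soliton ε z 0 ^ 2 = Real.sin α := by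
    rw [soliton_sq, hsin, ← Real.cosh_neg, ← hεL]
    congr 2
    field_simp
    ring
  set c := soliton ε z 0
  let k : ℝ → ℝ := fun x ↦ c * (x / vert) ^ n
  let k' : ℝ → ℝ := fun x ↦ c * (n * (x / vert) ^ (n - 1) * (1 / vert))
  have hk : ∀ x, HasDerivAt k (k' x) x := fun x ↦
    (((hasDerivAt_id x).div_const vert).pow n).const_mul c
  have hkc : Continuous k := by fun_prop
  have hkc' : Continuous k' := by fun_prop
  have hfc := continuous_soliton ε z
  have hfc' := continuous_solitonDeriv hε z
  have i1 := integral_soliton_sq hε z L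
  have i2 := integral_solitonDeriv_sq hε z L
  have i3 := integral_soliton_pow_six hε z L
  rw [hz1, hz2, harctan] at i1 i2 i3
  rw [hsc] at i2 i3
  have hpow : ∀ p : ℕ, ∫ x in (0 : ℝ)..vert, (x / vert) ^ p = vert / (p + 1) := fun p ↦ by
    rw [intervalIntegral.integral_comp_div (fun x ↦ x ^ p) hv.ne']
    simp [hv.ne', integral_pow]
    ring
  have j1 : ∫ x in (0 : ℝ)..vert, k x ^ 2 ≤ ε * Real.sin α := by
    have : ∀ x, k x ^ 2 = c ^ 2 * (x / vert) ^ (2 * n) := fun x ↦ by simp only [k]; ring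
    simp only [this]
    rw [intervalIntegral.integral_const_mul, hpow, hc2, mul_comm ε]
    have hs : 0 ≤ Real.sin α := by rw [hsin]; positivity
    gcongr
    rw [hεdef]
    push_cast
    gcongr
    linarith
  have j2 : ∫ x in (0 : ℝ)..vert, k' x ^ 2 ≤ Real.sin α / (3 * ε) := by
    have : ∀ x, k' x ^ 2 = c ^ 2 * (n / vert) ^ 2 * (x / vert) ^ (2 * (n - 1)) := fun x ↦ by
      simp only [k']; ring
    simp only [this]
    rw [intervalIntegral.integral_const_mul, hpow, hc2, mul_assoc, div_eq_mul_inv (Real.sin α)]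
    have hs : 0 ≤ Real.sin α := by rw [hsin]; positivity
    refine mul_le_mul_of_nonneg_left ?_ hs
    push_cast [Nat.cast_sub (show 1 ≤ n by omega)]
    have hn1 : 0 < 2 * (n : ℝ) - 1 := by linarith
    rw [show ((n : ℝ) / vert) ^ 2 * (vert / (2 * ((n : ℝ) - 1) + 1)) = n ^ 2 / (vert * (2 * n - 1))
        by rw [show 2 * ((n : ℝ) - 1) + 1 = 2 * n - 1 by ring]; field_simp,
      show (3 * ε)⁻¹ = 2 * n / (3 * vert) by rw [hεdef]; field_simp,
      div_le_div_iff₀ (by positivity) (by positivity)]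
    nlinarith [mul_nonneg (mul_nonneg hv.le (by linarith : (0 : ℝ) ≤ n))
      (by linarith : (0 : ℝ) ≤ n - 2)]
  have hJ1 : 0 ≤ ∫ x in (0 : ℝ)..vert, k x ^ 2 :=
    intervalIntegral.integral_nonneg hv.le fun x _ ↦ sq_nonneg _
  have hJ2 : 0 ≤ ∫ x in (0 : ℝ)..vert, k' x ^ 2 :=
    intervalIntegral.integral_nonneg hv.le fun x _ ↦ sq_nonneg _
  have hs0 : 0 < Real.sin α := by rw [hsin]; positivity
  have hssc : Real.sin α * Real.cos α ≤ α := by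
    nlinarith [Real.sin_le hα0.le, Real.cos_le_one α]
  have hsc0 : 0 < Real.sin α * Real.cos α := by
    rw [← hsc]
    have := Real.sinh_pos_iff.2 hL
    positivity
  have hpi := Real.pi_gt_three
  have hI1 : 0 < ε * (2 * (Real.pi / 2 - α)) := mul_pos hε (by linarith)
  have hI2 : 0 < 1 / (4 * ε) * (Real.pi / 2 - α - Real.sin α * Real.cos α) :=
    mul_pos (by positivity) (by linarith)
  have hI3 : 0 < ε * (Real.pi / 2 - α + Real.sin α * Real.cos α) := mul_pos hε (by linarith)
  refine MetricGraph.ofReal_lt_gnConst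
    (m := ε * (2 * (Real.pi / 2 - α)) + ∫ x in (0 : ℝ)..vert, k x ^ 2)
    (D := 1 / (4 * ε) * (Real.pi / 2 - α - Real.sin α * Real.cos α)
      + ∫ x in (0 : ℝ)..vert, k' x ^ 2)
    (isH1_singleSignpost (hasDerivAt_soliton hε z) hfc' hk hkc' hsym
      (by simp [k, hv.ne', c]) (by simp [k, show n ≠ 0 by omega]))
    (by linarith) (by linarith) ?_ ?_ ?_ hI3 ?_
  · rw [powNorm_singleSignpost two_ne_zero,
      powNormOn_Ioo_eq_ofReal_intervalIntegral hc.le even_two hfc,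
      powNormOn_Ioo_eq_ofReal_intervalIntegral hv.le even_two hkc, i1, ENNReal.ofReal_add hI1.le hJ1]
  · rw [powNorm_singleSignpost two_ne_zero,
      powNormOn_Ioo_eq_ofReal_intervalIntegral hc.le even_two hfc',
      powNormOn_Ioo_eq_ofReal_intervalIntegral hv.le even_two hkc', i2,
      ENNReal.ofReal_add hI2.le hJ2]
  · rw [powNorm_singleSignpost (by norm_num),
      powNormOn_Ioo_eq_ofReal_intervalIntegral hc.le (by decide) hfc, i3]
    exact le_self_add
  · have hm : ε * (2 * (Real.pi / 2 - α)) + ∫ x in (0 : ℝ)..vert, k x ^ 2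
        ≤ ε * (Real.pi - 2 * α + Real.sin α) := by linarith
    have hD : 1 / (4 * ε) * (Real.pi / 2 - α - Real.sin α * Real.cos α)
        + ∫ x in (0 : ℝ)..vert, k' x ^ 2
        ≤ 1 / ε * ((Real.pi / 2 - α - Real.sin α * Real.cos α) / 4 + Real.sin α / 3) := by
      refine (add_le_add_right j2 _).trans_eq ?_
      field_simp
    calc _ ≤ 4 / Real.pi ^ 2 * ((ε * (Real.pi - 2 * α + Real.sin α)) ^ 2 *
          (1 / ε * ((Real.pi / 2 - α - Real.sin α * Real.cos α) / 4 + Real.sin α / 3))) := by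
          gcongr
      _ = ε / Real.pi ^ 2 * (4 * (Real.pi - 2 * α + Real.sin α) ^ 2 *
          ((Real.pi / 2 - α - Real.sin α * Real.cos α) / 4 + Real.sin α / 3)) := by
          field_simp
      _ < ε / Real.pi ^ 2 * (Real.pi ^ 2 * (Real.pi / 2 - α + Real.sin α * Real.cos α)) := by
          have := four_mul_sq_mul_lt hα0 hα1
          gcongr
      _ = _ := by field_simp

/-! ### Comparison of the critical masses -/

theorem proposition4p2 (circ vert horiz : ℝ) (hc : 0 < circ) (hv : 0 < vert) (hh : 0 < horiz) :
    0 < (signpostGraph circ vert horiz hc hv hh).criticalMass ∧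
      (signpostGraph circ vert horiz hc hv hh).criticalMass < lineCriticalMass ∧
      lineCriticalMass < ⊤ := by
  have h1 := signpostGraph_gnConst_lt_top circ vert horiz hc hv hh
  have h2 := lineGNConst_le.trans_lt (ofReal_lt_signpostGraph_gnConst circ vert horiz hc hv hh)
  have h3 := lineGNConst_pos
  refine ⟨?_, ?_, ?_⟩
  · exact ENNReal.rpow_pos (ENNReal.div_pos (by norm_num) h1.ne)
      (ENNReal.div_ne_top (by norm_num) (h3.trans h2).ne')
  · refine ENNReal.rpow_lt_rpow ?_ (by norm_num)
    exact ENNReal.div_lt_div_left (by norm_num) (by norm_num) h2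
  · exact ENNReal.rpow_lt_top_of_nonneg (by norm_num)
      (ENNReal.div_ne_top (by norm_num) h3.ne')
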